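/- **Conventions.** All graphs are finite and simple, $K$ is a field. For a graph $G$ on a vertex set $V$ let $S_G=K[x_v,y_v : v\in V]$, and let $J_G\subset S_G$ be the binomial edge ideal, generated by the binomials $x_uy_v-x_vy_u$ with $\{u,v\}\in E(G)$. For $T\subseteq V$ let $P_T(G)\subset S_G$ be the ideal generated by $\{x_i,y_i : i\in T\}$ and by the ideals $J_{\widetilde G_1},\dots,J_{\widetilde G_{c}}$, where $G_1,\dots,G_c$ are the connected components of the induced subgraph of $G$ on $V\setminus T$ and $\widetilde G_j$ is the complete graph on the vertex set of $G_j$. A vertex is a cut point of a graph if its deletion gives a graph with more connected components. $T\subseteq V$ has the cut point property for $G$ if each $i\in T$ is a cut point of the subgraph of $G$ induced on $(V\setminus T)\cup\{i\}$. Put $\mathcal C(G)=\{\emptyset\}\cup\{T\subseteq V : T \text{ has the cut point property for } G\}$ and $\overline{\mathcal C}(G)=\mathcal C(G)\setminus\{\emptyset\}$. The join $G*H$ of graphs on disjoint vertex sets is the disjoint union of $G$ and $H$ together with all edges between a vertex of $G$ and a vertex of $H$. For collections of sets, $\mathcal A\circ\mathcal B=\{A\cup B : A\in\mathcal A,\ B\in\mathcal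 B\}$ and $\bigcirc_{i=1}^r\mathcal A_i=\{\bigcup_{i=1}^r A_i : A_i\in\mathcal A_i \text{ for all } i\}$. Height is the height of an ideal, and $\dim$ is Krull dimension. **Proposition 4.4.** Let $r\ge 2$ and let $G_1,H_1,\dots,H_r$ be connected (in particular nonempty) graphs on pairwise disjoint vertex sets $[t],[n_1],\dots,[n_r]$ with $t,n_1,\dots,n_r$ elements, respectively. Let $G_2=\bigsqcup_{i=1}^r H_i$ be the disjoint union of the $H_i$, and let $n=t+\sum_{i=1}^r n_i$. Then: (a) $\displaystyle \mathcal C(G_1*G_2)=\{\emptyset\}\cup\Big(\big(\bigcirc_{i=1}^r\mathcal C(H_i)\big)\circ\{[t]\}\Big)\cup\Big(\overline{\mathcal C}(G_1)\circ\big\{\textstyle\bigcup_{i=1}^r[n_i]\big\}\Big).$ (b) $\displaystyle \operatorname{height} J_{G_1*G_2}=\min\Big\{2t+\sum_{i=1}^r\operatorname{height}J_{H_i},\ 2(n-t)+\operatorname{height}P_T(G_1),\ n-1 \ :\ T\in\overline{\mathcal C}(G_1)\Big\}.$ (c) $\displaystyle \dim S/J_{G_1*G_2}=\max\Big\{\sum_{i=1}^r\dim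 S_{H_i}/J_{H_i},\ \dim S_{G_1}/P_T(G_1),\ n+1 \ :\ T\in\overline{\mathcal C}(G_1)\Big\},$ where $S=S_{G_1*G_2}$. -/

import Mathlib

namespace BinomialEdge

section Graphs

/-- The join `G * H`: the disjoint union of `G` and `H` together with all edges between the two
vertex sets. -/
def graphJoin {V W : Type*} (G : SimpleGraph V) (H : SimpleGraph W) : SimpleGraph (V ⊕ W) :=
  (G ⊕g H) ⊔ completeBipartiteGraph V W

/-- The disjoint union of a family of graphs on pairwise disjoint vertex sets. -/
def disjointUnion {ι : Type*} {W : ι → Type*} (H : ∀ i, SimpleGraph (W i)) :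
    SimpleGraph (Σ i, W i) where
  Adj a b := ∃ (i : ι) (u v : W i), a = ⟨i, u⟩ ∧ b = ⟨i, v⟩ ∧ (H i).Adj u v
  symm := ⟨fun _ _ ⟨i, u, v, ha, hb, h⟩ => ⟨i, v, u, hb, ha, h.symm⟩⟩
  loopless := ⟨by
    rintro _ ⟨i, u, v, rfl, hb, h⟩
    have : u = v := by simpa using hb
    exact h.ne this⟩

/-- The number of connected components of a (finite) graph. -/
noncomputable def numComponents {V : Type*} (G : SimpleGraph V) : ℕ :=
  Nat.card G.ConnectedComponent

/-- `v` is a cut point of the (finite) graph `G`: deleting `v` gives a graph with more connected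
components than `G`. -/
def IsCutPoint {V : Type*} (G : SimpleGraph V) (v : V) : Prop :=
  numComponents G < numComponents (G.induce ({v}ᶜ : Set V))

/-- `T` has the cut point property for `G`: each `i ∈ T` is a cut point of the subgraph of `G`
induced on `([n] ∖ T) ∪ {i}`. -/
def HasCutPointProperty {V : Type*} (G : SimpleGraph V) (T : Set V) : Prop :=
  ∀ i ∈ T, IsCutPoint (G.induce (insert i Tᶜ)) ⟨i, Set.mem_insert i Tᶜ⟩

/-- The collection `𝒞(G)`. -/
def cutSets {V : Type*} (G : SimpleGraph V) : Set (Set V) :=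
  {∅} ∪ {T | HasCutPointProperty G T}

/-- The collection of nonempty members of `𝒞(G)`. -/
def nonemptyCutSets {V : Type*} (G : SimpleGraph V) : Set (Set V) :=
  cutSets G \ {∅}

/-- The join of two collections of subsets: all `A ∪ B` with `A ∈ 𝒜`, `B ∈ ℬ`. -/
def collJoin {α : Type*} (𝒜 ℬ : Set (Set α)) : Set (Set α) :=
  {C | ∃ A ∈ 𝒜, ∃ B ∈ ℬ, C = A ∪ B}

/-- The join of a family of collections of subsets: all `⋃ i, A i` with `A i ∈ 𝒜 i` for all `i`. -/
def collJoinFamily {ι α : Type*} (𝒜 : ι → Set (Set α)) : Set (Set α) :=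
  {C | ∃ A : ι → Set α, (∀ i, A i ∈ 𝒜 i) ∧ C = ⋃ i, A i}

end Graphs

section Ideals

variable (K : Type*) [Field K]

/-- The polynomial ring `K[x_v, y_v : v ∈ V]`; `x_v` is the variable `Sum.inl v` and `y_v` is the
variable `Sum.inr v`. -/
abbrev PolyRing (V : Type*) : Type _ := MvPolynomial (V ⊕ V) K

/-- The variable `x_v`. -/
noncomputable def xVar {V : Type*} (v : V) : PolyRing K V := MvPolynomial.X (Sum.inl v)

/-- The variable `y_v`. -/
noncomputable def yVar {V : Type*} (v : V) : PolyRing K V := MvPolynomial.X (Sum.inr v)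

/-- The binomial edge ideal `J_G`, generated by `x_u y_v - x_v y_u` for the edges `{u, v}` of `G`.
Both orders of the two ends are listed; they give the same generator up to sign. -/
noncomputable def binomialEdgeIdeal {V : Type*} (G : SimpleGraph V) : Ideal (PolyRing K V) :=
  Ideal.span {f | ∃ u v : V, G.Adj u v ∧ f = xVar K u * yVar K v - xVar K v * yVar K u}

/-- The ideal `P_T(G)`, generated by `x_i, y_i` for `i ∈ T` and by the binomial edge ideals of the
complete graphs on the vertex sets of the connected components of `G` induced on `V ∖ T`. -/
noncomputable def primeOf {V : Type*} (G : SimpleGraph V) (T : Set V) : Ideal (PolyRing K V) :=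
  Ideal.span {f | ∃ i ∈ T, f = xVar K i ∨ f = yVar K i} ⊔
    ⨆ C : (G.induce Tᶜ).ConnectedComponent,
      binomialEdgeIdeal K (⊤ : SimpleGraph (Subtype.val '' C.supp : Set V)).spanningCoe

end Ideals

end BinomialEdge

/-!
A prime containing `J_G` contains `P_T(G)` for the set `T` of vertices `v` with both `x_v` and `y_v`
in it. A prime contains `P_T(G)` if and only if it contains the kernel of the substitution
`x_v ↦ s_v a_c`, `y_v ↦ s_v b_c`, where `c` is the component of `v` outside `T` and `s_v = 0` for
`v ∈ T`. This kernel is prime, so heights and dimensions can be computed from it without knowing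
that `P_T(G)` itself is prime. Merging components one at a time, then killing the `x_v` and finally
the `y_v`, gives explicit chains of primes below and above the kernel whose total length is
`2n = dim S`; hence `P_T(G)` has height `|T| + n - c(T)` and dimension `n - |T| + c(T)`, where
`c(T)` is the number of components outside `T`.

A set `T` belongs to `𝒞(G)` exactly when `c` drops on removing any one element from `T`. Hence a set
`T` minimizing `|T| - c(T)` lies in `𝒞(G)`, and the height and the dimension of `J_G` are extrema
over `𝒞(G)`. In a join, `c(T) = 1` unless `T` contains one of the two vertex sets, which determines
`𝒞(G * H)`; in a disjoint union, `c` is additive.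
-/

namespace BinomialEdge

section OrderAndIdeals

lemma isLeast_singleton_union {α : Type*} [PartialOrder α] {s t : Set α} {a m : α}
    (hm : IsLeast (s ∪ t) m) (ha : IsLeast s a) : IsLeast ({a} ∪ t) m := by
  refine ⟨hm.1.imp_left fun hms => ?_, ?_⟩
  · exact le_antisymm (hm.2 (Or.inl ha.1)) (ha.2 hms)
  · rintro _ (rfl | hb)
    exacts [hm.2 (Or.inl ha.1), hm.2 (Or.inr hb)]

lemma eq_and_eq_of_add_le {a b : ℕ} {x y : ℕ∞} (ha : a ≤ x) (hb : b ≤ y)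
    (h : x + y ≤ (a + b : ℕ)) : x = a ∧ y = b := by
  lift x to ℕ using (le_self_add.trans h).trans_lt (ENat.natCast_lt_top _) |>.ne
  lift y to ℕ using (le_add_self.trans h).trans_lt (ENat.natCast_lt_top _) |>.ne
  norm_cast at *
  omega

lemma height_add_ncard_le {α P : Type*} [Preorder P] (f : Set α → P) {M : Set α} (hM : M.Finite)
    (hf : ∀ a ∈ M, ∀ s, a ∉ s → f s < f (insert a s)) :
    Order.height (f ∅) + M.ncard ≤ Order.height (f M) := by
  induction M, hM using Set.Finite.induction_on with
  | empty => simp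
  | @insert a M ha hM ih =>
    calc Order.height (f ∅) + (insert a M).ncard = Order.height (f ∅) + M.ncard + 1 := by
          rw [Set.ncard_insert_of_notMem ha hM, Nat.cast_add_one, add_assoc]
      _ ≤ Order.height (f M) + 1 := by
          gcongr
          exact ih fun b hb => hf b (Set.mem_insert_of_mem a hb)
      _ ≤ Order.height (f (insert a M)) :=
          Order.height_add_one_le (hf a (Set.mem_insert a M) M ha)

lemma coheight_add_ncard_le {α P : Type*} [Preorder P] (f : Set α → P) {M : Set α}
    (hM : M.Finite) (hf : ∀ a ∈ M, ∀ s, a ∉ s → f s < f (insert a s)) :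
    Order.coheight (f M) + M.ncard ≤ Order.coheight (f ∅) := by
  induction M, hM using Set.Finite.induction_on with
  | empty => simp
  | @insert a M ha hM ih =>
    calc Order.coheight (f (insert a M)) + (insert a M).ncard
        = Order.coheight (f (insert a M)) + 1 + M.ncard := by
          rw [Set.ncard_insert_of_notMem ha hM, Nat.cast_add_one, add_assoc, add_comm 1]
      _ ≤ Order.coheight (f M) + M.ncard := by
          gcongr
          exact Order.coheight_add_one_le (hf a (Set.mem_insert a M) M ha)
      _ ≤ Order.coheight (f ∅) := ih fun b hb => hf b (Set.mem_insert_of_mem a hb)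

variable {R : Type*} [CommRing R] {I : Ideal R}

open PrimeSpectrum

lemma height_le_of_zeroLocus_subset {J : Ideal R}
    (h : zeroLocus (J : Set R) ⊆ zeroLocus I) : I.height ≤ J.height := by
  rw [J.height_eq_inf_minimalPrimes]
  refine le_iInf₂ fun p hp => Ideal.height_mono ?_
  exact h (show (⟨p, hp.1.1⟩ : PrimeSpectrum R) ∈ zeroLocus (J : Set R) from hp.1.2)

lemma height_eq_of_zeroLocus_eq_Ici {q : PrimeSpectrum R} (h : zeroLocus (I : Set R) = Set.Ici q) :
    I.height = Order.height q := by
  have hq : q ∈ zeroLocus (I : Set R) := h.symm.subset Set.self_mem_Ici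
  rw [← PrimeSpectrum.height_eq_orderHeight]
  refine le_antisymm (Ideal.height_mono hq) ?_
  rw [I.height_eq_inf_minimalPrimes]
  refine le_iInf₂ fun p hp => Ideal.height_mono ?_
  exact h.subset (show (⟨p, hp.1.1⟩ : PrimeSpectrum R) ∈ zeroLocus (I : Set R) from hp.1.2)

lemma ringKrullDim_quotient_eq_of_zeroLocus_eq_Ici {q : PrimeSpectrum R}
    (h : zeroLocus (I : Set R) = Set.Ici q) : ringKrullDim (R ⧸ I) = Order.coheight q := by
  rw [ringKrullDim_quotient, Order.coheight_eq_krullDim_Ici, h]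

lemma height_eq_iInf_of_zeroLocus_eq_iUnion {ι : Type*} {P : ι → Ideal R}
    (h : zeroLocus (I : Set R) = ⋃ i, zeroLocus (P i : Set R)) : I.height = ⨅ i, (P i).height := by
  refine le_antisymm (le_iInf fun i => height_le_of_zeroLocus_subset ?_) ?_
  · exact h ▸ Set.subset_iUnion_of_subset i subset_rfl
  · rw [I.height_eq_inf_minimalPrimes]
    refine le_iInf₂ fun p hp => ?_
    have hpI : (⟨p, hp.1.1⟩ : PrimeSpectrum R) ∈ zeroLocus (I : Set R) := hp.1.2
    obtain ⟨i, hi⟩ := Set.mem_iUnion.1 (h ▸ hpI)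
    exact (iInf_le _ i).trans (Ideal.height_mono hi)

lemma ringKrullDim_quotient_eq_iSup_of_zeroLocus_eq_iUnion {ι : Type*} {P : ι → Ideal R}
    (h : zeroLocus (I : Set R) = ⋃ i, zeroLocus (P i : Set R)) :
    ringKrullDim (R ⧸ I) = ⨆ i, ringKrullDim (R ⧸ P i) := by
  simp only [ringKrullDim_quotient]
  refine le_antisymm (iSup_le fun l => ?_) (iSup_le fun i => ?_)
  · obtain ⟨i, hi⟩ := Set.mem_iUnion.1 (h.subset l.head.2)
    have hmem (k) : (l k : PrimeSpectrum R) ∈ zeroLocus (P i : Set R) :=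
      hi.trans (show l.head.1.asIdeal ≤ (l k).1.asIdeal from l.head_le k)
    exact (le_iSup (fun l : LTSeries (zeroLocus (P i : Set R)) => (l.length : WithBot ℕ∞))
      ⟨l.length, fun k => ⟨l k, hmem k⟩, l.step⟩).trans
        (le_iSup (fun i => Order.krullDim (zeroLocus (P i : Set R))) i)
  · exact Order.krullDim_le_of_strictMono
      (Set.inclusion ((Set.subset_iUnion _ i).trans h.superset)) fun _ _ hab => hab

end OrderAndIdeals

section LabelPrimes

open MvPolynomial PrimeSpectrum

variable (K : Type*) [Field K] {V L : Type*}

open Classical in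
/-- The substitution `x_v ↦ s_v a_{c v}`, `y_v ↦ s_v b_{c v}` attached to a labelling `c` of the
vertices, with `s_v = 0` for `v ∈ T` and `a_l = 0` for `l ∈ A`. The variables `s_v`, `a_l`, `b_l`
of the target are indexed by the three summands of `V ⊕ L ⊕ L`. -/
noncomputable def labelMap (T : Set V) (A : Set L) (c : V → L) :
    PolyRing K V →ₐ[K] MvPolynomial (V ⊕ L ⊕ L) K :=
  aeval (Sum.elim
    (fun v => if v ∈ T ∨ c v ∈ A then 0 else X (Sum.inl v) * X (Sum.inr (Sum.inl (c v))))
    (fun v => if v ∈ T then 0 else X (Sum.inl v) * X (Sum.inr (Sum.inr (c v)))))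

/-- The kernel of `labelMap K T A c` as a point of the spectrum. For `A = ∅` it is the generic
point of the variety of those families of vectors `(x_v, y_v)` that vanish on `T` and are
proportional on the rest of each fibre of `c`. -/
noncomputable def labelPrime (T : Set V) (A : Set L) (c : V → L) :
    PrimeSpectrum (PolyRing K V) :=
  ⟨RingHom.ker (labelMap K T A c), RingHom.ker_isPrime _⟩

variable {K} {T : Set V} {A : Set L} {c : V → L} {u v : V}

open Classical in
@[simp] lemma labelMap_xVar : labelMap K T A c (xVar K v) =
    if v ∈ T ∨ c v ∈ A then 0 else X (Sum.inl v) * X (Sum.inr (Sum.inl (c v))) := by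
  simp [labelMap, xVar]

open Classical in
@[simp] lemma labelMap_yVar : labelMap K T A c (yVar K v) =
    if v ∈ T then 0 else X (Sum.inl v) * X (Sum.inr (Sum.inr (c v))) := by
  simp [labelMap, yVar]

lemma mem_labelPrime {f : PolyRing K V} :
    f ∈ (labelPrime K T A c).asIdeal ↔ labelMap K T A c f = 0 := Iff.rfl

lemma xVar_mem_labelPrime : xVar K v ∈ (labelPrime K T A c).asIdeal ↔ v ∈ T ∨ c v ∈ A := by
  simp [mem_labelPrime, or_iff_not_imp_left]

lemma yVar_mem_labelPrime : yVar K v ∈ (labelPrime K T A c).asIdeal ↔ v ∈ T := by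
  simp [mem_labelPrime]

lemma minor_mem_labelPrime_of_eq (h : c u = c v) :
    xVar K u * yVar K v - xVar K v * yVar K u ∈ (labelPrime K T A c).asIdeal := by
  rw [mem_labelPrime]
  by_cases hu : u ∈ T <;> by_cases hv : v ∈ T <;> by_cases hA : c v ∈ A <;> simp [hu, hv, h, hA]
  ring

lemma minor_notMem_labelPrime (hu : u ∉ T) (hv : v ∉ T) (hA : c u ∉ A) (h : c u ≠ c v) :
    xVar K u * yVar K v - xVar K v * yVar K u ∉ (labelPrime K T A c).asIdeal := by
  classical
  rw [mem_labelPrime]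
  intro h0
  have := congrArg (aeval (R := K) (S₁ := K) (Sum.elim (fun _ => (1 : K))
    (Sum.elim (Pi.single (c u) 1) (Pi.single (c v) 1)))) h0
  by_cases hAv : c v ∈ A <;> simp [hu, hv, hA, hAv, h] at this

lemma exists_common_direction {ι F : Type*} [Field F] (x y : ι → F)
    (h : ∀ i j, x i * y j - x j * y i = 0) :
    ∃ a b : F, ∀ i, ∃ s, x i = s * a ∧ y i = s * b := by
  by_cases h0 : ∀ i, x i = 0 ∧ y i = 0
  · exact ⟨0, 0, fun i => ⟨0, by simpa using h0 i⟩⟩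
  obtain ⟨j, hj⟩ := not_forall.1 h0
  refine ⟨x j, y j, fun i => ?_⟩
  by_cases hx : x j = 0
  · have hy : y j ≠ 0 := fun hy => hj ⟨hx, hy⟩
    have hxi : x i = 0 := by simpa [hx, hy] using h i j
    exact ⟨y i / y j, by simp [hx, hxi], by field_simp⟩
  · refine ⟨x i / x j, by field_simp, ?_⟩
    field_simp
    linear_combination -h i j

lemma labelPrime_le_iff {p : PrimeSpectrum (PolyRing K V)} :
    labelPrime K T A c ≤ p ↔
      (∀ v, v ∈ T ∨ c v ∈ A → xVar K v ∈ p.asIdeal) ∧ (∀ v ∈ T, yVar K v ∈ p.asIdeal) ∧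
        ∀ u ∉ T, ∀ v ∉ T, c u = c v →
          xVar K u * yVar K v - xVar K v * yVar K u ∈ p.asIdeal := by
  refine ⟨fun h => ⟨fun v hv => h (xVar_mem_labelPrime.2 hv),
    fun v hv => h (yVar_mem_labelPrime.2 hv),
    fun u _ v _ huv => h (minor_mem_labelPrime_of_eq huv)⟩, fun ⟨hx, hy, hm⟩ => ?_⟩
  classical
  let F := FractionRing (PolyRing K V ⧸ p.asIdeal)
  let φ : PolyRing K V →ₐ[K] F :=
    (Algebra.ofId (PolyRing K V ⧸ p.asIdeal) F |>.restrictScalars K).comp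
      (Ideal.Quotient.mkₐ K p.asIdeal)
  have hφ (f) : φ f = 0 ↔ f ∈ p.asIdeal := by
    simp [φ, Algebra.ofId_apply, Ideal.Quotient.eq_zero_iff_mem]
  -- Over the residue field of `p`, the vectors with a common label lie on a common line.
  have hline (l : L) : ∃ a b : F, ∀ v : {v // v ∉ T ∧ c v = l},
      ∃ s, φ (xVar K v) = s * a ∧ φ (yVar K v) = s * b :=
    exists_common_direction _ _ fun u v => by
      simpa only [map_sub, map_mul] using (hφ _).2 (hm u u.2.1 v v.2.1 (u.2.2.trans v.2.2.symm))
  choose a b s hs using hline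
  let ψ : MvPolynomial (V ⊕ L ⊕ L) K →ₐ[K] F :=
    aeval (Sum.elim (fun v => if h : v ∉ T then s (c v) ⟨v, h, rfl⟩ else 0) (Sum.elim a b))
  have hψ : ψ.comp (labelMap K T A c) = φ := by
    refine MvPolynomial.algHom_ext fun i => ?_
    rcases i with v | v
    · change ψ (labelMap K T A c (xVar K v)) = φ (xVar K v)
      by_cases hv : v ∈ T ∨ c v ∈ A
      · simp [hv, (hφ _).2 (hx v hv)]
      · obtain ⟨hvT, hvA⟩ := not_or.1 hv
        simp [ψ, hvT, hvA, (hs (c v) ⟨v, hvT, rfl⟩).1]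
    · change ψ (labelMap K T A c (yVar K v)) = φ (yVar K v)
      by_cases hv : v ∈ T
      · simp [hv, (hφ _).2 (hy v hv)]
      · simp [hv, ψ, (hs (c v) ⟨v, hv, rfl⟩).2]
  intro f hf
  rw [← hφ, ← hψ, AlgHom.comp_apply, mem_labelPrime.1 hf, map_zero]

lemma labelPrime_lt_insert_label (hv : v ∉ T) (hc : c v ∉ A) :
    labelPrime K T A c < labelPrime K T (insert (c v) A) c := by
  refine lt_of_le_not_ge (labelPrime_le_iff.2 ⟨fun w hw => ?_, fun w hw => ?_, ?_⟩) fun h => ?_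
  · exact xVar_mem_labelPrime.2 (hw.imp_right (Set.mem_insert_of_mem _))
  · exact yVar_mem_labelPrime.2 hw
  · exact fun u _ w _ huw => minor_mem_labelPrime_of_eq huw
  · exact (xVar_mem_labelPrime.1 (h (xVar_mem_labelPrime.2 (.inr (Set.mem_insert _ _))))).elim hv hc

lemma labelPrime_lt_insert_vertex (hv : v ∉ T) :
    labelPrime K T A c < labelPrime K (insert v T) A c := by
  refine lt_of_le_not_ge (labelPrime_le_iff.2 ⟨fun w hw => ?_, fun w hw => ?_, ?_⟩) fun h => ?_
  · exact xVar_mem_labelPrime.2 (hw.imp_left (Set.mem_insert_of_mem _))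
  · exact yVar_mem_labelPrime.2 (Set.mem_insert_of_mem _ hw)
  · exact fun u _ w _ huw => minor_mem_labelPrime_of_eq huw
  · exact hv (yVar_mem_labelPrime.1 (h (yVar_mem_labelPrime.2 (Set.mem_insert _ _))))

lemma labelPrime_lt_of_merge {L' : Type*} {c' : V → L'} (hc : ∀ u v, c u = c v → c' u = c' v)
    (h : c u ≠ c v) (h' : c' u = c' v) : labelPrime K ∅ ∅ c < labelPrime K ∅ ∅ c' := by
  refine lt_of_le_not_ge (labelPrime_le_iff.2 ⟨by simp, by simp, fun w _ z _ hwz => ?_⟩)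
    fun hle => ?_
  · exact minor_mem_labelPrime_of_eq (hc w z hwz)
  · exact minor_notMem_labelPrime (Set.notMem_empty u) (Set.notMem_empty v)
      (Set.notMem_empty _) h (hle (minor_mem_labelPrime_of_eq h'))

lemma height_add_coheight_le [Finite V] (p : PrimeSpectrum (PolyRing K V)) :
    Order.height p + Order.coheight p ≤ (2 * Nat.card V : ℕ) := by
  have h : ringKrullDim (PolyRing K V) = ((2 * Nat.card V : ℕ) : ℕ∞) := by
    rw [MvPolynomial.ringKrullDim_of_isNoetherianRing]
    simp [two_mul]
  rw [ringKrullDim, Order.krullDim_eq_iSup_height_add_coheight_of_nonempty, WithBot.coe_inj] at h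
  exact h ▸ le_iSup (fun p : PrimeSpectrum (PolyRing K V) => Order.height p + Order.coheight p) p

section Representatives

variable [Finite V] {T : Set V} {c : V → V}

lemma ncard_le_height_labelPrime_of_idempotent (hc : ∀ v, c (c v) = c v) :
    ({v | c v ≠ v}.ncard : ℕ∞) ≤ Order.height (labelPrime K ∅ ∅ c) := by
  classical
  -- Relabel the vertices with `c v ≠ v` one at a time.
  let f (M : Set V) (v : V) : V := if v ∈ M then c v else v
  have hf : f {v | c v ≠ v} = c := by
    funext v
    by_cases hv : c v = v <;> simp [f, hv]
  have hfc (M v) : f M (c v) = c v := by simp [f, hc]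
  have hinsert {v} (hv : c v ≠ v) {M} (hM : v ∉ M) (u) :
      f (insert v M) u = if f M u = v then c v else f M u := by
    have hcu : c u ≠ v := fun h => hv (h ▸ hc u)
    by_cases hu : u ∈ M
    · simp [f, hu, hcu]
    · by_cases huv : u = v <;> simp [f, hu, huv, hM]
  have hlt (v) (hv : c v ≠ v) (M : Set V) (hM : v ∉ M) :
      labelPrime K ∅ ∅ (f M) < labelPrime K ∅ ∅ (f (insert v M)) := by
    refine labelPrime_lt_of_merge (u := v) (v := c v) (fun u w huw => ?_) ?_ ?_
    · simp only [hinsert hv hM, huw]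
    · simpa [hfc, f, hM] using hv.symm
    · simp [hfc, f]
  simpa only [hf] using le_of_add_le_right (height_add_ncard_le
    (fun M => labelPrime K ∅ ∅ (f M)) (Set.toFinite {v | c v ≠ v}) hlt)

lemma le_height_labelPrime (hc : ∀ v, c (c v) = c v) (hT : ∀ v, c v ∈ T → v ∈ T)
    (hfix : ∀ v ∈ T, c v = v) :
    (2 * T.ncard + {v | c v ≠ v}.ncard : ℕ∞) ≤ Order.height (labelPrime K T ∅ c) :=
  calc (2 * T.ncard + {v | c v ≠ v}.ncard : ℕ∞)
      = {v | c v ≠ v}.ncard + T.ncard + T.ncard := by ring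
    _ ≤ Order.height (labelPrime K ∅ ∅ c) + T.ncard + T.ncard := by
        gcongr
        exact ncard_le_height_labelPrime_of_idempotent hc
    _ ≤ Order.height (labelPrime K ∅ T c) + T.ncard := by
        gcongr
        refine height_add_ncard_le (fun A => labelPrime K ∅ A c) T.toFinite fun a ha A haA => ?_
        have hlt := labelPrime_lt_insert_label (K := K) (A := A) (c := c) (Set.notMem_empty a)
        rw [hfix a ha] at hlt
        exact hlt haA
    _ ≤ Order.height (labelPrime K T T c) :=
        height_add_ncard_le (fun S => labelPrime K S T c) T.toFinite
          fun _ _ _ h => labelPrime_lt_insert_vertex h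
    _ ≤ Order.height (labelPrime K T ∅ c) := by
        refine Order.height_mono (labelPrime_le_iff.2 ⟨fun v hv => ?_, fun v hv => ?_, ?_⟩)
        · exact xVar_mem_labelPrime.2 (.inl (hv.elim id (hT v)))
        · exact yVar_mem_labelPrime.2 hv
        · exact fun u _ v _ huv => minor_mem_labelPrime_of_eq huv

lemma le_coheight_labelPrime :
    (Tᶜ.ncard + {v | v ∉ T ∧ c v = v}.ncard : ℕ∞) ≤ Order.coheight (labelPrime K T ∅ c) := by
  set R := {v | v ∉ T ∧ c v = v}
  calc (Tᶜ.ncard + R.ncard : ℕ∞)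
      ≤ Order.coheight (labelPrime K (T ∪ Tᶜ) R c) + Tᶜ.ncard + R.ncard := by
        gcongr
        exact le_add_self
    _ ≤ Order.coheight (labelPrime K T R c) + R.ncard := by
        gcongr
        simpa only [Set.union_empty] using coheight_add_ncard_le
          (fun S => labelPrime K (T ∪ S) R c) Tᶜ.toFinite fun v hv S hS => by
            rw [Set.union_insert]
            exact labelPrime_lt_insert_vertex (by simp_all)
    _ ≤ Order.coheight (labelPrime K T ∅ c) := by
        refine coheight_add_ncard_le (fun A => labelPrime K T A c) R.toFinite fun v hv A hA => ?_
        have hlt := labelPrime_lt_insert_label (K := K) (A := A) (c := c) hv.1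
        rw [hv.2] at hlt
        exact hlt hA

lemma ncard_add_ncard_moved_add_ncard_fixed (hfix : ∀ v ∈ T, c v = v) :
    T.ncard + {v | c v ≠ v}.ncard + {v | v ∉ T ∧ c v = v}.ncard = Nat.card V := by
  rw [← Set.ncard_union_eq, ← Set.ncard_union_eq, ← Set.ncard_univ]
  · congr 1
    ext v
    by_cases hv : c v = v <;> simp [hv, em]
  · exact Set.disjoint_left.2 fun v hv hR => hv.elim hR.1 fun h => h hR.2
  · exact Set.disjoint_left.2 fun v hv h => h (hfix v hv)

lemma height_and_coheight_labelPrime (hc : ∀ v, c (c v) = c v) (hT : ∀ v, c v ∈ T → v ∈ T)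
    (hfix : ∀ v ∈ T, c v = v) :
    Order.height (labelPrime K T ∅ c) =
        (T.ncard + (Nat.card V - {v | v ∉ T ∧ c v = v}.ncard) : ℕ) ∧
      Order.coheight (labelPrime K T ∅ c) =
        (Tᶜ.ncard + {v | v ∉ T ∧ c v = v}.ncard : ℕ) := by
  have hcard := ncard_add_ncard_moved_add_ncard_fixed hfix
  have hcompl := Set.ncard_add_ncard_compl T
  have hle := le_height_labelPrime (K := K) hc hT hfix
  have hco := le_coheight_labelPrime (K := K) (T := T) (c := c)
  have hsum := height_add_coheight_le (labelPrime K T ∅ c)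
  set m := {v | c v ≠ v}.ncard
  refine eq_and_eq_of_add_le (le_of_eq_of_le ?_ hle) (le_of_eq_of_le ?_ hco)
    (hsum.trans_eq ?_) <;> norm_cast <;> omega

end Representatives

end LabelPrimes

section BinomialEdgeIdeals

open PrimeSpectrum

/-- The number `c(T)` of connected components of `G` after deletion of `T`. -/
noncomputable def numComponentsCompl {V : Type*} (G : SimpleGraph V) (T : Set V) : ℕ :=
  numComponents (G.induce Tᶜ)

variable {K : Type*} [Field K] {V : Type*} {G : SimpleGraph V} {T : Set V}

lemma binomialEdgeIdeal_le_iff {I : Ideal (PolyRing K V)} :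
    binomialEdgeIdeal K G ≤ I ↔
      ∀ u v, G.Adj u v → xVar K u * yVar K v - xVar K v * yVar K u ∈ I := by
  rw [binomialEdgeIdeal, Ideal.span_le]
  refine ⟨fun h u v huv => h ⟨u, v, huv, rfl⟩, ?_⟩
  rintro h _ ⟨u, v, huv, rfl⟩
  exact h u v huv

lemma primeOf_le_iff {I : Ideal (PolyRing K V)} :
    primeOf K G T ≤ I ↔ (∀ v ∈ T, xVar K v ∈ I ∧ yVar K v ∈ I) ∧
      ∀ u v : (Tᶜ : Set V), (G.induce Tᶜ).Reachable u v →
        xVar K (u : V) * yVar K (v : V) - xVar K (v : V) * yVar K (u : V) ∈ I := by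
  rw [primeOf, sup_le_iff, iSup_le_iff, Ideal.span_le]
  refine and_congr ⟨fun h v hv => ⟨h ⟨v, hv, Or.inl rfl⟩, h ⟨v, hv, Or.inr rfl⟩⟩, ?_⟩ ?_
  · rintro h _ ⟨v, hv, rfl | rfl⟩
    exacts [(h v hv).1, (h v hv).2]
  · simp only [binomialEdgeIdeal_le_iff, SimpleGraph.map_adj, SimpleGraph.top_adj]
    constructor
    · intro h u v huv
      by_cases hne : (u : V) = v
      · simp [hne]
      · exact h ((G.induce Tᶜ).connectedComponentMk u) u v
          ⟨⟨u, u, rfl, rfl⟩, ⟨v, v, SimpleGraph.ConnectedComponent.sound huv.symm, rfl⟩,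
            by simpa [Subtype.ext_iff] using hne, rfl, rfl⟩
    · rintro h C _ _ ⟨⟨_, u, hu, rfl⟩, ⟨_, v, hv, rfl⟩, -, rfl, rfl⟩
      exact h u v (SimpleGraph.ConnectedComponent.exact (hu.trans hv.symm))

lemma binomialEdgeIdeal_le_primeOf : binomialEdgeIdeal K G ≤ primeOf K G T := by
  rw [binomialEdgeIdeal_le_iff]
  intro u v huv
  obtain ⟨hvars, hminors⟩ := primeOf_le_iff.1 (le_refl (primeOf K G T))
  by_cases hu : u ∈ T
  · exact sub_mem (Ideal.mul_mem_right _ _ (hvars u hu).1) (Ideal.mul_mem_left _ _ (hvars u hu).2)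
  by_cases hv : v ∈ T
  · exact sub_mem (Ideal.mul_mem_left _ _ (hvars v hv).2) (Ideal.mul_mem_right _ _ (hvars v hv).1)
  · exact hminors ⟨u, hu⟩ ⟨v, hv⟩ (SimpleGraph.Adj.reachable huv)

lemma minor_mem_of_minor_mem {p : Ideal (PolyRing K V)} [hp : p.IsPrime] {u v w : V}
    (hv : ¬(xVar K v ∈ p ∧ yVar K v ∈ p))
    (huv : xVar K u * yVar K v - xVar K v * yVar K u ∈ p)
    (hvw : xVar K v * yVar K w - xVar K w * yVar K v ∈ p) :
    xVar K u * yVar K w - xVar K w * yVar K u ∈ p := by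
  by_cases hx : xVar K v ∈ p
  · refine (hp.mem_or_mem (x := yVar K v) ?_).resolve_left fun hy => hv ⟨hx, hy⟩
    convert add_mem (p.mul_mem_left (yVar K w) huv) (p.mul_mem_left (yVar K u) hvw) using 1
    ring
  · refine (hp.mem_or_mem (x := xVar K v) ?_).resolve_left hx
    convert add_mem (p.mul_mem_left (xVar K w) huv) (p.mul_mem_left (xVar K u) hvw) using 1
    ring

lemma exists_primeOf_le {p : Ideal (PolyRing K V)} [p.IsPrime] (h : binomialEdgeIdeal K G ≤ p) :
    ∃ T : Set V, primeOf K G T ≤ p := by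
  refine ⟨{v | xVar K v ∈ p ∧ yVar K v ∈ p}, primeOf_le_iff.2 ⟨fun v hv => hv, ?_⟩⟩
  rintro u v ⟨walk⟩
  induction walk with
  | nil => simp
  | @cons _ v _ huv _ ih =>
    exact minor_mem_of_minor_mem v.2 (binomialEdgeIdeal_le_iff.1 h _ _ huv) ih

lemma zeroLocus_binomialEdgeIdeal : zeroLocus (binomialEdgeIdeal K G : Set (PolyRing K V)) =
    ⋃ T, zeroLocus (primeOf K G T : Set (PolyRing K V)) := by
  ext p
  rw [Set.mem_iUnion]
  exact ⟨exists_primeOf_le, fun ⟨_, hT⟩ => binomialEdgeIdeal_le_primeOf.trans hT⟩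

variable (G T) in
open Classical in
/-- A choice of representatives of the connected components of `G` after deletion of `T`, extended
by the identity on `T`; the labelling whose label prime is the generic point of `P_T(G)`. -/
noncomputable def componentRep (v : V) : V :=
  if h : v ∈ T then v else
    (Quot.out ((G.induce Tᶜ).connectedComponentMk ⟨v, h⟩) : (Tᶜ : Set V))

lemma componentRep_of_mem {v : V} (h : v ∈ T) : componentRep G T v = v := dif_pos h

lemma componentRep_of_notMem {v : V} (h : v ∉ T) : componentRep G T v =
    (Quot.out ((G.induce Tᶜ).connectedComponentMk ⟨v, h⟩) : (Tᶜ : Set V)) := dif_neg h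

lemma mem_of_componentRep_mem {v : V} (h : componentRep G T v ∈ T) : v ∈ T := by
  by_contra hv
  rw [componentRep_of_notMem hv] at h
  exact (Subtype.prop _ : _ ∈ Tᶜ) h

lemma connectedComponentMk_out (C : G.ConnectedComponent) :
    G.connectedComponentMk (Quot.out C) = C := Quot.out_eq C

lemma componentRep_componentRep (v : V) :
    componentRep G T (componentRep G T v) = componentRep G T v := by
  by_cases h : v ∈ T
  · simp only [componentRep_of_mem h]
  · rw [componentRep_of_notMem (mt mem_of_componentRep_mem h)]
    simp only [componentRep_of_notMem h, Subtype.coe_eta, connectedComponentMk_out]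

lemma componentRep_eq_iff {u v : V} (hu : u ∉ T) (hv : v ∉ T) :
    componentRep G T u = componentRep G T v ↔ (G.induce Tᶜ).Reachable ⟨u, hu⟩ ⟨v, hv⟩ := by
  rw [componentRep_of_notMem hu, componentRep_of_notMem hv, Subtype.coe_inj,
    ← SimpleGraph.ConnectedComponent.eq]
  exact (Function.LeftInverse.injective connectedComponentMk_out).eq_iff

lemma ncard_fixed_componentRep :
    {v | v ∉ T ∧ componentRep G T v = v}.ncard = numComponentsCompl G T := by
  have hrange : {v | v ∉ T ∧ componentRep G T v = v} = Set.range
      fun C : (G.induce Tᶜ).ConnectedComponent => ((Quot.out C : (Tᶜ : Set V)) : V) := by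
    ext v
    constructor
    · rintro ⟨hv, h⟩
      exact ⟨_, (componentRep_of_notMem hv).symm.trans h⟩
    · rintro ⟨C, rfl⟩
      refine ⟨(Quot.out C).2, ?_⟩
      rw [componentRep_of_notMem (Quot.out C).2, Subtype.coe_eta, connectedComponentMk_out]
  rw [hrange, Set.ncard_range_of_injective, numComponentsCompl, numComponents]
  exact Subtype.val_injective.comp (Function.LeftInverse.injective connectedComponentMk_out)

lemma zeroLocus_primeOf : zeroLocus (primeOf K G T : Set (PolyRing K V)) =
    Set.Ici (labelPrime K T ∅ (componentRep G T)) := by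
  ext p
  change primeOf K G T ≤ p.asIdeal ↔ labelPrime K T ∅ (componentRep G T) ≤ p
  rw [primeOf_le_iff, labelPrime_le_iff]
  simp only [Set.mem_empty_iff_false, or_false, forall_and, and_assoc]
  refine and_congr_right fun _ => and_congr_right fun _ => ⟨fun h u hu v hv huv => ?_, ?_⟩
  · exact h ⟨u, hu⟩ ⟨v, hv⟩ ((componentRep_eq_iff hu hv).1 huv)
  · exact fun h u v huv => h u u.2 v v.2 ((componentRep_eq_iff u.2 v.2).2 huv)

variable [Finite V]

lemma height_primeOf :
    (primeOf K G T).height = (T.ncard + (Nat.card V - numComponentsCompl G T) : ℕ) := by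
  rw [height_eq_of_zeroLocus_eq_Ici zeroLocus_primeOf, ← ncard_fixed_componentRep]
  exact (height_and_coheight_labelPrime componentRep_componentRep
    (fun _ => mem_of_componentRep_mem) fun _ => componentRep_of_mem).1

lemma ringKrullDim_quotient_primeOf : ringKrullDim (PolyRing K V ⧸ primeOf K G T) =
    (Tᶜ.ncard + numComponentsCompl G T : ℕ) := by
  rw [ringKrullDim_quotient_eq_of_zeroLocus_eq_Ici zeroLocus_primeOf, ← ncard_fixed_componentRep]
  exact congrArg _ (height_and_coheight_labelPrime componentRep_componentRep
    (fun _ => mem_of_componentRep_mem) fun _ => componentRep_of_mem).2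

lemma ncard_add_numComponentsCompl_le (G : SimpleGraph V) (T : Set V) :
    T.ncard + numComponentsCompl G T ≤ Nat.card V := by
  rw [← Set.ncard_add_ncard_compl T, ← Nat.card_coe_set_eq Tᶜ]
  gcongr
  exact Nat.card_le_card_of_surjective _ Quot.mk_surjective

end BinomialEdgeIdeals

section CutSets

variable {V W : Type*} {G : SimpleGraph V} {H : SimpleGraph W}

lemma numComponents_congr (e : G ≃g H) : numComponents G = numComponents H :=
  Nat.card_congr e.connectedComponentEquiv

lemma numComponents_eq_one (h : G.Connected) : numComponents G = 1 := by
  have := h.preconnected.subsingleton_connectedComponent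
  have := h.nonempty
  exact Nat.card_eq_one_iff_unique.2 ⟨inferInstance, inferInstance⟩

lemma two_le_numComponents [Finite V] (h : ¬G.Preconnected) : 2 ≤ numComponents G := by
  obtain ⟨u, v, huv⟩ : ∃ u v, ¬G.Reachable u v := by simpa [SimpleGraph.Preconnected] using h
  refine Finite.one_lt_card_iff_nontrivial.2
    ⟨G.connectedComponentMk u, G.connectedComponentMk v, fun h => huv ?_⟩
  exact SimpleGraph.ConnectedComponent.exact h

lemma numComponentsCompl_eq_of_range_eq {T : Set V} (f : H ↪g G) (hf : Set.range f = Tᶜ) :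
    numComponentsCompl G T = numComponents H := by
  rw [numComponentsCompl, ← hf]
  exact numComponents_congr f.isoInduceRange.symm

lemma numComponentsCompl_eq_of_image_compl_eq {S : Set V} {T : Set W} (f : H ↪g G)
    (hf : f '' Tᶜ = Sᶜ) : numComponentsCompl G S = numComponentsCompl H T :=
  numComponentsCompl_eq_of_range_eq (f.comp (SimpleGraph.Embedding.induce Tᶜ))
    (by rw [← hf, Set.image_eq_range]; rfl)

lemma numComponentsCompl_image (e : G ≃g H) (T : Set V) :
    numComponentsCompl H (e '' T) = numComponentsCompl G T :=
  numComponentsCompl_eq_of_image_compl_eq e.toEmbedding (Set.image_compl_eq e.bijective)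

lemma numComponentsCompl_empty : numComponentsCompl G ∅ = numComponents G :=
  numComponentsCompl_eq_of_range_eq SimpleGraph.Embedding.refl (by
    rw [Set.compl_empty]
    exact Set.range_id)

lemma numComponentsCompl_pos [Finite V] {T : Set V} {v : V} (hv : v ∉ T) :
    0 < numComponentsCompl G T :=
  have : Nonempty (G.induce Tᶜ).ConnectedComponent :=
    ⟨(G.induce Tᶜ).connectedComponentMk ⟨v, hv⟩⟩
  Nat.card_pos

lemma exists_notMem_of_numComponentsCompl_pos {T : Set V} (h : 0 < numComponentsCompl G T) :
    ∃ v, v ∉ T := by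
  obtain ⟨C⟩ := (Nat.card_pos_iff.1 h).1
  exact ⟨(Quot.out C : (Tᶜ : Set V)), (Quot.out C).2⟩

lemma hasCutPointProperty_iff {T : Set V} : HasCutPointProperty G T ↔
    ∀ v ∈ T, numComponentsCompl G (T \ {v}) < numComponentsCompl G T := by
  refine forall₂_congr fun v hv => ?_
  have hdiff : (T \ {v})ᶜ = insert v Tᶜ := by
    rw [Set.sdiff_eq, Set.compl_inter, compl_compl, Set.union_comm, Set.singleton_union]
  have himage : Subtype.val '' ({⟨v, Set.mem_insert v Tᶜ⟩}ᶜ : Set (insert v Tᶜ : Set V)) = Tᶜ := by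
    ext w
    simp only [Set.mem_image, Set.mem_compl_iff, Set.mem_singleton_iff]
    aesop
  rw [IsCutPoint, numComponentsCompl_eq_of_image_compl_eq (SimpleGraph.Embedding.induce _) himage,
    numComponentsCompl, numComponentsCompl, hdiff]

lemma mem_cutSets_iff {T : Set V} : T ∈ cutSets G ↔
    ∀ v ∈ T, numComponentsCompl G (T \ {v}) < numComponentsCompl G T := by
  rw [← hasCutPointProperty_iff]
  refine ⟨?_, Or.inr⟩
  rintro (rfl | h)
  exacts [fun v hv => hv.elim, h]

lemma image_mem_cutSets_iff (e : G ≃g H) {T : Set V} : e '' T ∈ cutSets H ↔ T ∈ cutSets G := by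
  simp only [mem_cutSets_iff, Set.forall_mem_image, ← Set.image_singleton,
    ← Set.image_sdiff e.injective, numComponentsCompl_image]

lemma two_le_numComponentsCompl_of_mem_cutSets [Finite V] {T : Set V} (hT : T ∈ cutSets G)
    (h : T.Nonempty) : 2 ≤ numComponentsCompl G T := by
  obtain ⟨v, hv⟩ := h
  have hpos : 0 < numComponentsCompl G (T \ {v}) := numComponentsCompl_pos (v := v) (by simp)
  exact Nat.lt_of_le_of_lt hpos (mem_cutSets_iff.1 hT v hv)

lemma mem_nonemptyCutSets_iff [Finite V] (hG : G.Connected) {T : Set V} :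
    T ∈ nonemptyCutSets G ↔ T ∈ cutSets G ∧ 2 ≤ numComponentsCompl G T := by
  refine and_congr_right fun hT => ⟨fun h => ?_, ?_⟩
  · exact two_le_numComponentsCompl_of_mem_cutSets hT (Set.nonempty_iff_ne_empty.2 h)
  · rintro h rfl
    rw [numComponentsCompl_empty, numComponents_eq_one hG] at h
    omega

lemma two_le_numComponentsCompl_of_not_preconnected [Finite V] (hG : ¬G.Preconnected) {T : Set V}
    (hT : T ∈ cutSets G) : 2 ≤ numComponentsCompl G T := by
  obtain rfl | h := T.eq_empty_or_nonempty
  · rw [numComponentsCompl_empty]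
    exact two_le_numComponents hG
  · exact two_le_numComponentsCompl_of_mem_cutSets hT h

variable [Finite V]

lemma exists_mem_cutSets_forall_le (G : SimpleGraph V) : ∃ T ∈ cutSets G, ∀ T',
    T.ncard + numComponentsCompl G T' ≤ T'.ncard + numComponentsCompl G T := by
  obtain ⟨T, hT⟩ := Finite.exists_min fun T : Set V => (T.ncard : ℤ) - numComponentsCompl G T
  refine ⟨T, mem_cutSets_iff.2 fun v hv => ?_, fun T' => ?_⟩
  · have hmin := hT (T \ {v})
    have hcard := Set.ncard_sdiff_singleton_add_one hv
    omega
  · have hmin := hT T'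
    omega

variable (K : Type*) [Field K] (G)

lemma isLeast_height_binomialEdgeIdeal :
    IsLeast ((fun T => (primeOf K G T).height) '' cutSets G) (binomialEdgeIdeal K G).height := by
  rw [height_eq_iInf_of_zeroLocus_eq_iUnion zeroLocus_binomialEdgeIdeal]
  obtain ⟨T, hTcut, hT⟩ := exists_mem_cutSets_forall_le G
  refine ⟨⟨T, hTcut, le_antisymm (le_iInf fun T' => ?_) (iInf_le _ T)⟩, ?_⟩
  · have hmin := hT T'
    have hle := ncard_add_numComponentsCompl_le G T
    have hle' := ncard_add_numComponentsCompl_le G T'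
    simp only [height_primeOf, Nat.cast_le]
    omega
  · rintro _ ⟨T', -, rfl⟩
    exact iInf_le _ T'

lemma isGreatest_ringKrullDim_quotient_binomialEdgeIdeal :
    IsGreatest ((fun T => ringKrullDim (PolyRing K V ⧸ primeOf K G T)) '' cutSets G)
      (ringKrullDim (PolyRing K V ⧸ binomialEdgeIdeal K G)) := by
  rw [ringKrullDim_quotient_eq_iSup_of_zeroLocus_eq_iUnion zeroLocus_binomialEdgeIdeal]
  obtain ⟨T, hTcut, hT⟩ := exists_mem_cutSets_forall_le G
  refine ⟨⟨T, hTcut, le_antisymm (le_iSup_of_le T le_rfl) (iSup_le fun T' => ?_)⟩, ?_⟩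
  · have hmin := hT T'
    have hcard := Set.ncard_add_ncard_compl T
    have hcard' := Set.ncard_add_ncard_compl T'
    simp only [ringKrullDim_quotient_primeOf, Nat.cast_le]
    omega
  · rintro _ ⟨T', -, rfl⟩
    exact le_iSup_of_le T' le_rfl

variable {G}

lemma height_primeOf_empty (hG : G.Connected) :
    (primeOf K G ∅).height = (Nat.card V - 1 : ℕ) := by
  rw [height_primeOf, numComponentsCompl_empty, numComponents_eq_one hG, Set.ncard_empty, zero_add]

lemma ringKrullDim_quotient_primeOf_empty (hG : G.Connected) :
    ringKrullDim (PolyRing K V ⧸ primeOf K G ∅) = (Nat.card V + 1 : ℕ) := by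
  rw [ringKrullDim_quotient_primeOf, numComponentsCompl_empty, numComponents_eq_one hG,
    Set.compl_empty, Set.ncard_univ]

end CutSets

section Join

variable {V W : Type*} {G : SimpleGraph V} {H : SimpleGraph W}

@[simp] lemma graphJoin_adj_inl_inl {u v : V} :
    (graphJoin G H).Adj (Sum.inl u) (Sum.inl v) ↔ G.Adj u v := by simp [graphJoin]

@[simp] lemma graphJoin_adj_inr_inr {u v : W} :
    (graphJoin G H).Adj (Sum.inr u) (Sum.inr v) ↔ H.Adj u v := by simp [graphJoin]

@[simp] lemma graphJoin_adj_inl_inr {v : V} {w : W} :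
    (graphJoin G H).Adj (Sum.inl v) (Sum.inr w) := by simp [graphJoin]

@[simp] lemma graphJoin_adj_inr_inl {v : V} {w : W} :
    (graphJoin G H).Adj (Sum.inr w) (Sum.inl v) := by simp [graphJoin]

variable (G H) in
/-- The isomorphism `G * H ≃g H * G`, which reduces statements about the second factor of a join
to statements about the first one. -/
def graphJoinComm : graphJoin G H ≃g graphJoin H G where
  toEquiv := Equiv.sumComm V W
  map_rel_iff' {a b} := by rcases a with a | a <;> rcases b with b | b <;> simp

lemma numComponentsCompl_graphJoin_eq_one {T : Set (V ⊕ W)} {v : V} {w : W}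
    (hv : Sum.inl v ∉ T) (hw : Sum.inr w ∉ T) : numComponentsCompl (graphJoin G H) T = 1 := by
  have hadj {x y : V ⊕ W} (hx : x ∉ T) (hy : y ∉ T) (h : (graphJoin G H).Adj x y) :
      ((graphJoin G H).induce Tᶜ).Reachable ⟨x, hx⟩ ⟨y, hy⟩ :=
    SimpleGraph.Adj.reachable (G := (graphJoin G H).induce Tᶜ) h
  have hreach : ∀ x, ((graphJoin G H).induce Tᶜ).Reachable ⟨Sum.inl v, hv⟩ x := by
    rintro ⟨u | u, hu⟩
    · exact (hadj hv hw graphJoin_adj_inl_inr).trans (hadj hw hu graphJoin_adj_inr_inl)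
    · exact hadj hv hu graphJoin_adj_inl_inr
  exact numComponents_eq_one
    ((SimpleGraph.connected_iff_exists_forall_reachable _).2 ⟨_, hreach⟩)

lemma graphJoin_connected [Nonempty V] [Nonempty W] : (graphJoin G H).Connected := by
  inhabit V
  inhabit W
  refine (SimpleGraph.connected_iff_exists_forall_reachable _).2 ⟨Sum.inl default, ?_⟩
  have hadj (w : W) : (graphJoin G H).Adj (Sum.inl default) (Sum.inr w) := graphJoin_adj_inl_inr
  rintro (u | u)
  · exact (hadj default).reachable.trans graphJoin_adj_inr_inl.reachable
  · exact (hadj u).reachable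

lemma compl_image_inr_union_range_inl (T : Set W) :
    (Sum.inr '' T ∪ Set.range Sum.inl : Set (V ⊕ W))ᶜ = Sum.inr '' Tᶜ := by
  ext (x | x) <;> simp

lemma compl_image_inl_union_range_inr (T : Set V) :
    (Sum.inl '' T ∪ Set.range Sum.inr : Set (V ⊕ W))ᶜ = Sum.inl '' Tᶜ := by
  ext (x | x) <;> simp

lemma numComponentsCompl_image_inr_union_range_inl (T : Set W) :
    numComponentsCompl (graphJoin G H) (Sum.inr '' T ∪ Set.range Sum.inl) =
      numComponentsCompl H T :=
  numComponentsCompl_eq_of_image_compl_eq ⟨Function.Embedding.inr, graphJoin_adj_inr_inr⟩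
    (compl_image_inr_union_range_inl T).symm

lemma numComponentsCompl_image_inl_union_range_inr (T : Set V) :
    numComponentsCompl (graphJoin G H) (Sum.inl '' T ∪ Set.range Sum.inr) =
      numComponentsCompl G T :=
  numComponentsCompl_eq_of_image_compl_eq ⟨Function.Embedding.inl, graphJoin_adj_inl_inl⟩
    (compl_image_inl_union_range_inr T).symm

lemma image_inr_union_range_inl_mem_cutSets_iff [Nonempty V] {T : Set W} :
    Sum.inr '' T ∪ Set.range Sum.inl ∈ cutSets (graphJoin G H) ↔
      T ∈ cutSets H ∧ 2 ≤ numComponentsCompl H T := by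
  have hinr (w : W) : ((Sum.inr '' T ∪ Set.range Sum.inl) \ {Sum.inr w} : Set (V ⊕ W)) =
      Sum.inr '' (T \ {w}) ∪ Set.range Sum.inl := by
    ext (x | x) <;> simp
  have hinl (v : V) {w : W} (hw : w ∉ T) : numComponentsCompl (graphJoin G H)
      ((Sum.inr '' T ∪ Set.range Sum.inl) \ {Sum.inl v}) = 1 :=
    numComponentsCompl_graphJoin_eq_one (v := v) (w := w) (by simp) (by simp [hw])
  simp only [mem_cutSets_iff, numComponentsCompl_image_inr_union_range_inl, Set.mem_union,
    or_imp, forall_and, Set.forall_mem_image, Set.forall_mem_range, hinr]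
  refine and_congr_right fun _ => ⟨fun h => ?_, fun h v => ?_⟩
  · have hlt := h (Classical.arbitrary V)
    obtain ⟨w, hw⟩ := exists_notMem_of_numComponentsCompl_pos (Nat.zero_lt_of_lt hlt)
    rwa [hinl _ hw] at hlt
  · obtain ⟨w, hw⟩ := exists_notMem_of_numComponentsCompl_pos (Nat.zero_lt_of_lt h)
    rwa [hinl v hw]

lemma image_inl_union_range_inr_mem_cutSets_iff [Nonempty W] {T : Set V} :
    Sum.inl '' T ∪ Set.range Sum.inr ∈ cutSets (graphJoin G H) ↔
      T ∈ cutSets G ∧ 2 ≤ numComponentsCompl G T := by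
  rw [← image_inr_union_range_inl_mem_cutSets_iff (G := H),
    ← image_mem_cutSets_iff (graphJoinComm H G)]
  congr! 1
  ext (x | x) <;> simp [graphJoinComm]

lemma range_inl_subset_or_range_inr_subset [Finite V] [Finite W] {T : Set (V ⊕ W)}
    (hT : T ∈ cutSets (graphJoin G H)) (hne : T.Nonempty) :
    Set.range Sum.inl ⊆ T ∨ Set.range Sum.inr ⊆ T := by
  simp only [Set.range_subset_iff]
  by_contra! h
  obtain ⟨⟨v, hv⟩, w, hw⟩ := h
  have htwo := two_le_numComponentsCompl_of_mem_cutSets hT hne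
  rw [numComponentsCompl_graphJoin_eq_one hv hw] at htwo
  omega

lemma mem_cutSets_graphJoin_iff [Finite V] [Finite W] [Nonempty V] [Nonempty W]
    {T : Set (V ⊕ W)} : T ∈ cutSets (graphJoin G H) ↔ T = ∅ ∨
      (∃ A ∈ cutSets H, 2 ≤ numComponentsCompl H A ∧ Sum.inr '' A ∪ Set.range Sum.inl = T) ∨
      ∃ A ∈ cutSets G, 2 ≤ numComponentsCompl G A ∧ Sum.inl '' A ∪ Set.range Sum.inr = T := by
  constructor
  · intro hT
    refine or_iff_not_imp_left.2 fun hne => ?_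
    refine (range_inl_subset_or_range_inr_subset hT (Set.nonempty_iff_ne_empty.2 hne)).imp ?_ ?_
    · intro h
      have hA : Sum.inr '' (Sum.inr ⁻¹' T) ∪ Set.range Sum.inl = T := by
        rw [Set.image_preimage_eq_inter_range, Set.union_comm, Set.union_inter_distrib_left,
          Set.range_inl_union_range_inr, Set.inter_univ, Set.union_eq_right.2 h]
      rw [← hA, image_inr_union_range_inl_mem_cutSets_iff] at hT
      exact ⟨_, hT.1, hT.2, hA⟩
    · intro h
      have hA : Sum.inl '' (Sum.inl ⁻¹' T) ∪ Set.range Sum.inr = T := by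
        rw [Set.image_preimage_eq_inter_range, Set.union_comm, Set.union_inter_distrib_left,
          Set.range_inr_union_range_inl, Set.inter_univ, Set.union_eq_right.2 h]
      rw [← hA, image_inl_union_range_inr_mem_cutSets_iff] at hT
      exact ⟨_, hT.1, hT.2, hA⟩
  · rintro (rfl | ⟨A, hA, h2, rfl⟩ | ⟨A, hA, h2, rfl⟩)
    · exact Or.inl rfl
    · exact image_inr_union_range_inl_mem_cutSets_iff.2 ⟨hA, h2⟩
    · exact image_inl_union_range_inr_mem_cutSets_iff.2 ⟨hA, h2⟩

lemma cutSets_graphJoin [Finite V] [Finite W] (hG : G.Connected) (hH : ¬H.Preconnected) :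
    cutSets (graphJoin G H) = {∅} ∪ (fun A => Sum.inr '' A ∪ Set.range Sum.inl) '' cutSets H ∪
      (fun A => Sum.inl '' A ∪ Set.range Sum.inr) '' nonemptyCutSets G := by
  have := hG.nonempty
  have : Nonempty W := not_isEmpty_iff.1 fun _ => hH SimpleGraph.Preconnected.of_subsingleton
  ext T
  rw [mem_cutSets_graphJoin_iff, Set.mem_union, Set.mem_union, Set.mem_singleton_iff, or_assoc]
  refine or_congr_right (or_congr (exists_congr fun A => ?_) (exists_congr fun A => ?_))
  · exact and_congr_right fun hA =>
      and_iff_right (two_le_numComponentsCompl_of_not_preconnected hH hA)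
  · rw [mem_nonemptyCutSets_iff hG, and_assoc]

lemma isLeast_image_cutSets_graphJoin [Finite V] [Finite W] {M : Type*} [PartialOrder M]
    (hG : G.Connected) (hH : ¬H.Preconnected) {f : Set (V ⊕ W) → M} {a m : M}
    (hm : IsLeast (f '' cutSets (graphJoin G H)) m)
    (ha : IsLeast ((fun A => f (Sum.inr '' A ∪ Set.range Sum.inl)) '' cutSets H) a) :
    IsLeast ({a} ∪ {b | ∃ A ∈ nonemptyCutSets G, b = f (Sum.inl '' A ∪ Set.range Sum.inr)} ∪
      {f ∅}) m := by
  rw [cutSets_graphJoin hG hH, Set.union_assoc, Set.union_comm, Set.image_union, Set.image_union,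
    Set.image_image, Set.image_image, Set.image_singleton, Set.union_assoc] at hm
  simpa only [Set.image, Set.union_assoc, eq_comm] using isLeast_singleton_union hm ha

lemma isGreatest_image_cutSets_graphJoin [Finite V] [Finite W] {M : Type*} [PartialOrder M]
    (hG : G.Connected) (hH : ¬H.Preconnected) {f : Set (V ⊕ W) → M} {a m : M}
    (hm : IsGreatest (f '' cutSets (graphJoin G H)) m)
    (ha : IsGreatest ((fun A => f (Sum.inr '' A ∪ Set.range Sum.inl)) '' cutSets H) a) :
    IsGreatest ({a} ∪ {b | ∃ A ∈ nonemptyCutSets G, b = f (Sum.inl '' A ∪ Set.range Sum.inr)} ∪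
      {f ∅}) m :=
  isLeast_image_cutSets_graphJoin (M := Mᵒᵈ) hG hH hm ha

variable (K : Type*) [Field K]

lemma height_primeOf_image_inr_union_range_inl [Finite V] [Finite W] (T : Set W) :
    (primeOf K (graphJoin G H) (Sum.inr '' T ∪ Set.range Sum.inl)).height =
      (2 * Nat.card V : ℕ) + (primeOf K H T).height := by
  have hcard := Set.ncard_add_ncard_compl (Sum.inr '' T ∪ Set.range Sum.inl : Set (V ⊕ W))
  have hcardT := Set.ncard_add_ncard_compl T
  have hle := ncard_add_numComponentsCompl_le H T
  rw [compl_image_inr_union_range_inl, Set.ncard_image_of_injective _ Sum.inr_injective,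
    Nat.card_sum] at hcard
  rw [height_primeOf, height_primeOf, numComponentsCompl_image_inr_union_range_inl,
    Nat.card_sum, ← Nat.cast_add]
  congr 1
  omega

lemma height_primeOf_image_inl_union_range_inr [Finite V] [Finite W] (T : Set V) :
    (primeOf K (graphJoin G H) (Sum.inl '' T ∪ Set.range Sum.inr)).height =
      (2 * Nat.card W : ℕ) + (primeOf K G T).height := by
  have hcard := Set.ncard_add_ncard_compl (Sum.inl '' T ∪ Set.range Sum.inr : Set (V ⊕ W))
  have hcardT := Set.ncard_add_ncard_compl T
  have hle := ncard_add_numComponentsCompl_le G T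
  rw [compl_image_inl_union_range_inr, Set.ncard_image_of_injective _ Sum.inl_injective,
    Nat.card_sum] at hcard
  rw [height_primeOf, height_primeOf, numComponentsCompl_image_inl_union_range_inr,
    Nat.card_sum, ← Nat.cast_add]
  congr 1
  omega

lemma ringKrullDim_quotient_primeOf_image_inr_union_range_inl [Finite V] [Finite W] (T : Set W) :
    ringKrullDim (PolyRing K (V ⊕ W) ⧸
        primeOf K (graphJoin G H) (Sum.inr '' T ∪ Set.range Sum.inl)) =
      ringKrullDim (PolyRing K W ⧸ primeOf K H T) := by
  rw [ringKrullDim_quotient_primeOf, ringKrullDim_quotient_primeOf,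
    numComponentsCompl_image_inr_union_range_inl, compl_image_inr_union_range_inl,
    Set.ncard_image_of_injective _ Sum.inr_injective]

lemma ringKrullDim_quotient_primeOf_image_inl_union_range_inr [Finite V] [Finite W] (T : Set V) :
    ringKrullDim (PolyRing K (V ⊕ W) ⧸
        primeOf K (graphJoin G H) (Sum.inl '' T ∪ Set.range Sum.inr)) =
      ringKrullDim (PolyRing K V ⧸ primeOf K G T) := by
  rw [ringKrullDim_quotient_primeOf, ringKrullDim_quotient_primeOf,
    numComponentsCompl_image_inl_union_range_inr, compl_image_inl_union_range_inr,
    Set.ncard_image_of_injective _ Sum.inl_injective]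

lemma isLeast_height_binomialEdgeIdeal_graphJoin [Finite V] [Finite W] (hG : G.Connected)
    (hH : ¬H.Preconnected) :
    IsLeast ({(2 * Nat.card V : ℕ) + (binomialEdgeIdeal K H).height} ∪
        {h | ∃ T ∈ nonemptyCutSets G, h = (2 * Nat.card W : ℕ) + (primeOf K G T).height} ∪
        {((Nat.card (V ⊕ W) - 1 : ℕ) : ℕ∞)})
      (binomialEdgeIdeal K (graphJoin G H)).height := by
  have := hG.nonempty
  have : Nonempty W := not_isEmpty_iff.1 fun _ => hH SimpleGraph.Preconnected.of_subsingleton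
  have hleast := (add_right_mono (a := ((2 * Nat.card V : ℕ) : ℕ∞))).map_isLeast
    (isLeast_height_binomialEdgeIdeal H K)
  rw [Set.image_image] at hleast
  have hjoin := isLeast_image_cutSets_graphJoin hG hH
    (isLeast_height_binomialEdgeIdeal (graphJoin G H) K)
    (by simpa only [height_primeOf_image_inr_union_range_inl] using hleast)
  simpa only [height_primeOf_image_inl_union_range_inr,
    height_primeOf_empty K graphJoin_connected] using hjoin

lemma isGreatest_ringKrullDim_quotient_binomialEdgeIdeal_graphJoin [Finite V] [Finite W]
    (hG : G.Connected) (hH : ¬H.Preconnected) :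
    IsGreatest ({ringKrullDim (PolyRing K W ⧸ binomialEdgeIdeal K H)} ∪
        {d | ∃ T ∈ nonemptyCutSets G, d = ringKrullDim (PolyRing K V ⧸ primeOf K G T)} ∪
        {((Nat.card (V ⊕ W) + 1 : ℕ) : WithBot ℕ∞)})
      (ringKrullDim (PolyRing K (V ⊕ W) ⧸ binomialEdgeIdeal K (graphJoin G H))) := by
  have := hG.nonempty
  have : Nonempty W := not_isEmpty_iff.1 fun _ => hH SimpleGraph.Preconnected.of_subsingleton
  have hjoin := isGreatest_image_cutSets_graphJoin hG hH
    (isGreatest_ringKrullDim_quotient_binomialEdgeIdeal (graphJoin G H) K)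
    (by simpa only [ringKrullDim_quotient_primeOf_image_inr_union_range_inl] using
      isGreatest_ringKrullDim_quotient_binomialEdgeIdeal H K)
  simpa only [ringKrullDim_quotient_primeOf_image_inl_union_range_inr,
    ringKrullDim_quotient_primeOf_empty K graphJoin_connected] using hjoin

end Join

section DisjointUnion

variable {ι : Type*} {W W' : ι → Type*} {H : ∀ i, SimpleGraph (W i)} {H' : ∀ i, SimpleGraph (W' i)}

lemma fst_eq_of_disjointUnion_adj {x y : Σ i, W i} (h : (disjointUnion H).Adj x y) :
    x.1 = y.1 := by
  obtain ⟨i, u, v, rfl, rfl, -⟩ := h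
  rfl

@[simp] lemma disjointUnion_adj_mk {i : ι} {u v : W i} :
    (disjointUnion H).Adj ⟨i, u⟩ ⟨i, v⟩ ↔ (H i).Adj u v := by
  refine ⟨?_, fun h => ⟨i, u, v, rfl, rfl, h⟩⟩
  rintro ⟨j, u', v', hu, hv, h⟩
  obtain ⟨rfl, hu⟩ := Sigma.mk.inj_iff.1 hu
  cases hu
  cases hv
  exact h

/-- The embedding of disjoint unions given by embeddings of the summands. -/
def disjointUnionMap (f : ∀ i, H' i ↪g H i) : disjointUnion H' ↪g disjointUnion H where
  toEmbedding := .sigmaMap (.refl ι) fun i => (f i).toEmbedding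
  map_rel_iff' {x y} := by
    obtain ⟨i, u⟩ := x
    obtain ⟨j, v⟩ := y
    by_cases hij : i = j
    · subst hij
      exact disjointUnion_adj_mk.trans ((f i).map_adj_iff.trans disjointUnion_adj_mk.symm)
    · exact iff_of_false (fun h => hij (fst_eq_of_disjointUnion_adj h))
        fun h => hij (fst_eq_of_disjointUnion_adj h)

lemma disjointUnion_reachable_iff {x y : Σ i, W i} : (disjointUnion H).Reachable x y ↔
    (⟨x.1, (H x.1).connectedComponentMk x.2⟩ : Σ i, (H i).ConnectedComponent) =
      ⟨y.1, (H y.1).connectedComponentMk y.2⟩ := by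
  constructor
  · rintro ⟨p⟩
    induction p with
    | nil => rfl
    | cons hxy p ih =>
      obtain ⟨i, u, v, rfl, rfl, huv⟩ := hxy
      rw [← ih, SimpleGraph.ConnectedComponent.connectedComponentMk_eq_of_adj huv]
  · obtain ⟨i, u⟩ := x
    obtain ⟨j, v⟩ := y
    intro h
    obtain ⟨rfl, h⟩ := Sigma.mk.inj_iff.1 h
    exact (SimpleGraph.ConnectedComponent.exact (eq_of_heq h)).map
      ⟨Sigma.mk i, disjointUnion_adj_mk.2⟩

lemma not_preconnected_disjointUnion [Nontrivial ι] [∀ i, Nonempty (W i)] :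
    ¬(disjointUnion H).Preconnected := by
  obtain ⟨i, j, hij⟩ := exists_pair_ne ι
  obtain ⟨u⟩ := ‹∀ i, Nonempty (W i)› i
  obtain ⟨v⟩ := ‹∀ i, Nonempty (W i)› j
  exact fun h => hij (Sigma.mk.inj_iff.1 (disjointUnion_reachable_iff.1 (h ⟨i, u⟩ ⟨j, v⟩))).1

variable [∀ i, Finite (W i)]

lemma numComponents_disjointUnion [Fintype ι] :
    numComponents (disjointUnion H) = ∑ i, numComponents (H i) := by
  simp only [numComponents]
  rw [← Nat.card_sigma]
  refine Nat.card_congr (Equiv.ofBijective (SimpleGraph.ConnectedComponent.lift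
    (fun x => ⟨x.1, (H x.1).connectedComponentMk x.2⟩)
    fun x y p _ => disjointUnion_reachable_iff.1 p.reachable) ⟨?_, ?_⟩)
  · refine SimpleGraph.ConnectedComponent.ind₂ fun x y h => ?_
    exact SimpleGraph.ConnectedComponent.sound (disjointUnion_reachable_iff.2 h)
  · rintro ⟨i, C⟩
    induction C using SimpleGraph.ConnectedComponent.ind with | h v
    exact ⟨(disjointUnion H).connectedComponentMk ⟨i, v⟩, rfl⟩

lemma numComponentsCompl_disjointUnion [Fintype ι] (T : Set (Σ i, W i)) :
    numComponentsCompl (disjointUnion H) T = ∑ i, numComponentsCompl (H i) (Sigma.mk i ⁻¹' T) := by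
  refine (numComponentsCompl_eq_of_range_eq (disjointUnionMap fun i =>
    SimpleGraph.Embedding.induce (Sigma.mk i ⁻¹' T)ᶜ) ?_).trans numComponents_disjointUnion
  ext ⟨i, w⟩
  constructor
  · rintro ⟨⟨j, u, hu⟩, h⟩
    exact h ▸ hu
  · exact fun hw => ⟨⟨i, w, hw⟩, rfl⟩

lemma ncard_eq_sum_ncard_preimage_mk [Fintype ι] (T : Set (Σ i, W i)) :
    T.ncard = ∑ i, (Sigma.mk i ⁻¹' T).ncard := by
  simp only [← Nat.card_coe_set_eq]
  rw [← Nat.card_sigma]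
  exact Nat.card_congr
    { toFun w := ⟨w.1.1, w.1.2, w.2⟩
      invFun w := ⟨⟨w.1, w.2.1⟩, w.2.2⟩ }

lemma mem_cutSets_disjointUnion_iff [Finite ι] {T : Set (Σ i, W i)} :
    T ∈ cutSets (disjointUnion H) ↔ ∀ i, Sigma.mk i ⁻¹' T ∈ cutSets (H i) := by
  classical
  have := Fintype.ofFinite ι
  have hcount (i : ι) (w : W i) :
      numComponentsCompl (disjointUnion H) (T \ {⟨i, w⟩}) < numComponentsCompl (disjointUnion H) T ↔
        numComponentsCompl (H i) (Sigma.mk i ⁻¹' T \ {w}) <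
          numComponentsCompl (H i) (Sigma.mk i ⁻¹' T) := by
    have hi : Sigma.mk i ⁻¹' (T \ {⟨i, w⟩}) = Sigma.mk i ⁻¹' T \ {w} := by
      ext
      simp
    have hj {j : ι} (h : j ≠ i) : Sigma.mk j ⁻¹' (T \ {⟨i, w⟩}) = Sigma.mk j ⁻¹' T := by
      ext
      simp [h]
    rw [numComponentsCompl_disjointUnion, numComponentsCompl_disjointUnion,
      Fintype.sum_eq_add_sum_compl i, Fintype.sum_eq_add_sum_compl i, hi,
      Finset.sum_congr rfl fun j hj' => by rw [hj (by simpa using hj')], add_lt_add_iff_right]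
  simp only [mem_cutSets_iff, Sigma.forall, hcount, Set.mem_preimage]

lemma sigma_mem_cutSets_disjointUnion [Finite ι] {T : ∀ i, Set (W i)}
    (hT : ∀ i, T i ∈ cutSets (H i)) :
    Set.univ.sigma T ∈ cutSets (disjointUnion H) :=
  mem_cutSets_disjointUnion_iff.2 fun i => by
    rw [Set.mk_preimage_sigma (Set.mem_univ i)]
    exact hT i

lemma image_cutSets_disjointUnion [Finite ι] {α : Type*} (f : (Σ i, W i) → α) :
    (fun T => f '' T) '' cutSets (disjointUnion H) =
      collJoinFamily fun i => (fun T : Set (W i) => (fun w => f ⟨i, w⟩) '' T) '' cutSets (H i) := by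
  ext C
  constructor
  · rintro ⟨T, hT, rfl⟩
    refine ⟨_, fun i => ⟨_, mem_cutSets_disjointUnion_iff.1 hT i, rfl⟩, ?_⟩
    ext
    simp
  · rintro ⟨A, hA, rfl⟩
    choose T hT hTA using hA
    refine ⟨Set.univ.sigma T, sigma_mem_cutSets_disjointUnion hT, ?_⟩
    ext
    simp [← hTA]

lemma isLeast_image_cutSets_disjointUnion [Fintype ι] {M : Type*} [AddCommMonoid M]
    [PartialOrder M] [IsOrderedAddMonoid M] {f : ∀ i, Set (W i) → M} {a : ι → M}
    (h : ∀ i, IsLeast (f i '' cutSets (H i)) (a i)) :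
    IsLeast ((fun T => ∑ i, f i (Sigma.mk i ⁻¹' T)) '' cutSets (disjointUnion H)) (∑ i, a i) := by
  choose T hT hTa using fun i => (h i).1
  refine ⟨⟨Set.univ.sigma T, sigma_mem_cutSets_disjointUnion hT, ?_⟩, ?_⟩
  · simp only [Set.mk_preimage_sigma (Set.mem_univ _), hTa]
  · rintro _ ⟨S, hS, rfl⟩
    exact Finset.sum_le_sum fun i _ =>
      (h i).2 (Set.mem_image_of_mem _ (mem_cutSets_disjointUnion_iff.1 hS i))

lemma isGreatest_image_cutSets_disjointUnion [Fintype ι] {M : Type*} [AddCommMonoid M]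
    [PartialOrder M] [IsOrderedAddMonoid M] {f : ∀ i, Set (W i) → M} {a : ι → M}
    (h : ∀ i, IsGreatest (f i '' cutSets (H i)) (a i)) :
    IsGreatest ((fun T => ∑ i, f i (Sigma.mk i ⁻¹' T)) '' cutSets (disjointUnion H))
      (∑ i, a i) :=
  isLeast_image_cutSets_disjointUnion (M := Mᵒᵈ) h

variable [Fintype ι] (K : Type*) [Field K] (H)

lemma height_primeOf_disjointUnion (T : Set (Σ i, W i)) :
    (primeOf K (disjointUnion H) T).height = ∑ i, (primeOf K (H i) (Sigma.mk i ⁻¹' T)).height := by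
  simp only [height_primeOf]
  rw [ncard_eq_sum_ncard_preimage_mk, numComponentsCompl_disjointUnion, Nat.card_sigma,
    ← Finset.sum_tsub_distrib, ← Finset.sum_add_distrib, Nat.cast_sum]
  exact fun i _ => le_add_self.trans (ncard_add_numComponentsCompl_le (H i) _)

lemma ringKrullDim_quotient_primeOf_disjointUnion (T : Set (Σ i, W i)) :
    ringKrullDim (PolyRing K (Σ i, W i) ⧸ primeOf K (disjointUnion H) T) =
      ∑ i, ringKrullDim (PolyRing K (W i) ⧸ primeOf K (H i) (Sigma.mk i ⁻¹' T)) := by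
  simp only [ringKrullDim_quotient_primeOf]
  rw [ncard_eq_sum_ncard_preimage_mk, numComponentsCompl_disjointUnion,
    ← Finset.sum_add_distrib, Nat.cast_sum]
  rfl

theorem height_binomialEdgeIdeal_disjointUnion :
    (binomialEdgeIdeal K (disjointUnion H)).height = ∑ i, (binomialEdgeIdeal K (H i)).height := by
  refine (isLeast_height_binomialEdgeIdeal _ K).unique ?_
  simp only [height_primeOf_disjointUnion]
  exact isLeast_image_cutSets_disjointUnion fun i => isLeast_height_binomialEdgeIdeal (H i) K

theorem ringKrullDim_quotient_binomialEdgeIdeal_disjointUnion :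
    ringKrullDim (PolyRing K (Σ i, W i) ⧸ binomialEdgeIdeal K (disjointUnion H)) =
      ∑ i, ringKrullDim (PolyRing K (W i) ⧸ binomialEdgeIdeal K (H i)) := by
  refine (isGreatest_ringKrullDim_quotient_binomialEdgeIdeal _ K).unique ?_
  simp only [ringKrullDim_quotient_primeOf_disjointUnion]
  exact isGreatest_image_cutSets_disjointUnion fun i =>
    isGreatest_ringKrullDim_quotient_binomialEdgeIdeal (H i) K

end DisjointUnion

lemma collJoin_singleton {α : Type*} (𝒜 : Set (Set α)) (B : Set α) :
    collJoin 𝒜 {B} = (fun A => A ∪ B) '' 𝒜 := by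
  ext C
  simp [collJoin, eq_comm]

end BinomialEdge

open BinomialEdge in
theorem proposition4p4_general {K : Type*} [Field K] {ι : Type*} [Fintype ι] [Nontrivial ι]
    {V : Type*} [Finite V] {W : ι → Type*} [∀ i, Finite (W i)] [∀ i, Nonempty (W i)]
    {G₁ : SimpleGraph V} (H : ∀ i, SimpleGraph (W i)) (hG₁ : G₁.Connected) :
    cutSets (graphJoin G₁ (disjointUnion H)) =
        {∅} ∪
        collJoin
          (collJoinFamily fun i =>
            (fun T : Set (W i) => (fun w => Sum.inr ⟨i, w⟩) '' T) '' cutSets (H i))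
          {Set.range Sum.inl} ∪
        collJoin ((fun T : Set V => Sum.inl '' T) '' nonemptyCutSets G₁) {Set.range Sum.inr} ∧
    IsLeast
      ({((2 * Nat.card V : ℕ) : ℕ∞) + ∑ i, (binomialEdgeIdeal K (H i)).height} ∪
        {h | ∃ T ∈ nonemptyCutSets G₁,
          h = ((2 * Nat.card (Σ i, W i) : ℕ) : ℕ∞) + (primeOf K G₁ T).height} ∪
        {((Nat.card (V ⊕ Σ i, W i) - 1 : ℕ) : ℕ∞)})
      (binomialEdgeIdeal K (graphJoin G₁ (disjointUnion H))).height ∧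
    IsGreatest
      ({∑ i, ringKrullDim (PolyRing K (W i) ⧸ binomialEdgeIdeal K (H i))} ∪
        {d | ∃ T ∈ nonemptyCutSets G₁, d = ringKrullDim (PolyRing K V ⧸ primeOf K G₁ T)} ∪
        {((Nat.card (V ⊕ Σ i, W i) + 1 : ℕ) : WithBot ℕ∞)})
      (ringKrullDim (PolyRing K (V ⊕ Σ i, W i) ⧸
        binomialEdgeIdeal K (graphJoin G₁ (disjointUnion H)))) := by
  have hH : ¬(disjointUnion H).Preconnected := not_preconnected_disjointUnion
  refine ⟨?_, ?_, ?_⟩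
  · rw [cutSets_graphJoin hG₁ hH, ← image_cutSets_disjointUnion, collJoin_singleton,
      collJoin_singleton, Set.image_image, Set.image_image]
  · rw [← height_binomialEdgeIdeal_disjointUnion]
    exact isLeast_height_binomialEdgeIdeal_graphJoin K hG₁ hH
  · rw [← ringKrullDim_quotient_binomialEdgeIdeal_disjointUnion]
    exact isGreatest_ringKrullDim_quotient_binomialEdgeIdeal_graphJoin K hG₁ hH

open BinomialEdge in
theorem proposition4p4 {K : Type*} [Field K] {r : ℕ} (hr : 2 ≤ r)
    {V : Type*} [Fintype V] {W : Fin r → Type*} [∀ i, Fintype (W i)]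
    (G₁ : SimpleGraph V) (H : ∀ i, SimpleGraph (W i))
    (hG₁ : G₁.Connected) (hH : ∀ i, (H i).Connected)
    (t n : ℕ) (N : Fin r → ℕ)
    (ht : Fintype.card V = t) (hN : ∀ i, Fintype.card (W i) = N i) (hn : n = t + ∑ i, N i) :
    -- (a)
    cutSets (graphJoin G₁ (disjointUnion H)) =
        {∅} ∪
        collJoin
          (collJoinFamily fun i =>
            (fun T : Set (W i) => (fun w => Sum.inr ⟨i, w⟩) '' T) '' cutSets (H i))
          {Set.range Sum.inl} ∪
        collJoin ((fun T : Set V => Sum.inl '' T) '' nonemptyCutSets G₁) {Set.range Sum.inr} ∧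
    -- (b)
    IsLeast
      ({((2 * t : ℕ) : ℕ∞) + ∑ i, (binomialEdgeIdeal K (H i)).height} ∪
        {h | ∃ T ∈ nonemptyCutSets G₁,
          h = ((2 * (n - t) : ℕ) : ℕ∞) + (primeOf K G₁ T).height} ∪
        {((n - 1 : ℕ) : ℕ∞)})
      (binomialEdgeIdeal K (graphJoin G₁ (disjointUnion H))).height ∧
    -- (c)
    IsGreatest
      ({∑ i, ringKrullDim (PolyRing K (W i) ⧸ binomialEdgeIdeal K (H i))} ∪
        {d | ∃ T ∈ nonemptyCutSets G₁, d = ringKrullDim (PolyRing K V ⧸ primeOf K G₁ T)} ∪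
        {((n + 1 : ℕ) : WithBot ℕ∞)})
      (ringKrullDim (PolyRing K (V ⊕ Σ i, W i) ⧸
        binomialEdgeIdeal K (graphJoin G₁ (disjointUnion H)))) := by
  have := Fin.nontrivial_iff_two_le.2 hr
  have := fun i => (hH i).nonempty
  simpa [ht, hN, hn] using proposition4p4_general (K := K) H hG₁
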